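/- Let $\mathcal M_a=(\mathcal N,\mathcal I_a)$ and $\mathcal M_b=(\mathcal N,\mathcal I_b)$ be two matroids on a common finite ground set $\mathcal N$ with $n$ elements, accessed through independence queries (one query asks whether a given set is independent in one of the two matroids). Let $w:\mathcal N\to\mathbb R_{\ge 0}$ be weights whose maximum is $W$ (more generally, let $W$ be any upper bound on the weights), and write $w(T)=\sum_{e\in T}w(e)$. For $\varepsilon>0$ consider the following algorithm. 1. Set $p(e)=0$, $w_a(e)=w(e)$, $w_b(e)=0$ for all $e\in\mathcal N$. Let $S_a$ be a maximum weight base of $\mathcal M_a$ with respect to $w_a$ and $S_b$ a maximum weight base of $\mathcal M_b$ with respect to $w_b$. 2. Let $X=\{e\in S_a\setminus S_b : p(e)<2\lceil \varepsilon^{-1}\rceil\}$. If $|X|\le\varepsilon n$, return $S=S_a\cap S_b$. 3. For every $e\in X$: increase $p(e)$ by $1$; if $w_a(e)+w_b(e)=w(e)$, increase $w_b(e)$ by $\varepsilon(1-\varepsilon)w(e)$, otherwise decrease $w_a(e)$ by $\varepsilon(1-\varepsilon)w(e)$. 4. For $i\in\{a,b\}$ replace $S_i$ by a maximum weight base of $\mathcal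 M_i$ with respect to $w_i$, where ties are broken in favour of the elements of the old $S_i$ (and otherwise arbitrarily). Go to step 2. Every base is computed by the greedy algorithm: the elements are processed by decreasing weight (in step 4, among equal weights the elements of the old $S_i$ first), with one independence query per element. Then, however the remaining ties are broken, the algorithm terminates and returns a common independent set $S\in\mathcal I_a\cap\mathcal I_b$ with $$w(S)\ \ge\ w(S^*)-3\varepsilon W n,$$ where $S^*$ is a common independent set of maximum weight. Moreover, there is an absolute constant $C$ such that for $0<\varepsilon\le 1$ the algorithm asks at most $C\,n/\varepsilon^2$ independence queries in total. -/

import Mathlib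

namespace AuctionMI

/-- The two matroids of an intersection instance. -/
inductive Side where
  | a
  | b

/-- An adaptive algorithm with independence-oracle access to two matroids on the ground set `α`:
it either returns a value, or asks whether a set is independent in one of the two matroids and
continues depending on the answer.  It has no other access to the matroids. -/
inductive OracleProg (α : Type*) (β : Type*) where
  | ret : β → OracleProg α β
  | ask : Side → Finset α → (Bool → OracleProg α β) → OracleProg α β

namespace OracleProg

variable {α β γ : Type*}

/-- Sequential composition. -/
def bind : OracleProg α β → (β → OracleProg α γ) → OracleProg α γ
  | ret x, f => f x
  | ask i T k, f => ask i T (fun ans => bind (k ans) f)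

/-- Execution with a given pair of oracles: the returned value together with the number of
queries asked. -/
def run (O : Side → Finset α → Bool) : OracleProg α β → β × ℕ
  | ret x => (x, 0)
  | ask i T k => ((run O (k (O i T))).1, (run O (k (O i T))).2 + 1)

end OracleProg

/-- `WhileRuns O body s x q`: with oracles `O`, iterating `body` from the state `s` until it returns
a result (`Sum.inr`) rather than a new state (`Sum.inl`) terminates after finitely many iterations,
with result `x` and `q` oracle queries in total. -/
inductive WhileRuns {α σ β : Type*} (O : Side → Finset α → Bool)
    (body : σ → OracleProg α (σ ⊕ β)) : σ → β → ℕ → Prop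
  | done {s : σ} {x : β} {q : ℕ} (h : (body s).run O = (Sum.inr x, q)) :
      WhileRuns O body s x q
  | step {s s' : σ} {x : β} {q q' : ℕ} (h : (body s).run O = (Sum.inl s', q))
      (h' : WhileRuns O body s' x q') : WhileRuns O body s x (q + q')

noncomputable section

variable {α : Type*}

open Classical in
/-- The pair of independence oracles of two matroids. -/
def indepOracle (Ma Mb : Matroid α) : Side → Finset α → Bool
  | Side.a, T => decide (Ma.Indep (T : Set α))
  | Side.b, T => decide (Mb.Indep (T : Set α))

open Classical in
/-- The greedy processing order for the weights `u`: decreasing weight, among elements of equal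
weight those of `old` first, and the remaining ties in the order of the list `tie`. -/
def greedyOrder (tie : List α) (u : α → ℝ) (old : Finset α) : List α :=
  tie.mergeSort (fun x y => decide (u y < u x ∨ (u x = u y ∧ (y ∈ old → x ∈ old))))

open Classical in
/-- The greedy pass: go through the list and add every element that keeps the current set
independent in the matroid `i`, with one independence query per element. -/
def greedy (i : Side) : List α → Finset α → OracleProg α (Finset α)
  | [], S => .ret S
  | e :: l, S => .ask i (insert e S) (fun ans => greedy i l (if ans then insert e S else S))

/-- Computation of a maximum weight base of the matroid `i` for the weights `u`, preferring elements
of `old` in case of ties.  As `tie` ranges over all enumerations of the ground set, this gives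
every maximum weight base with the largest possible intersection with `old`. -/
def maxWeightBase (i : Side) (tie : List α) (u : α → ℝ) (old : Finset α) :
    OracleProg α (Finset α) :=
  greedy i (greedyOrder tie u old) ∅

/-- The variables of the auction algorithm. -/
structure State (α : Type*) where
  /-- number of completed iterations -/
  round : ℕ
  /-- number of weight adjustments of each element -/
  p : α → ℕ
  /-- the weights for the first matroid -/
  wa : α → ℝ
  /-- the weights for the second matroid -/
  wb : α → ℝ
  /-- current base of the first matroid -/
  Sa : Finset α
  /-- current base of the second matroid -/
  Sb : Finset α

/-- Initialization: `p = 0`, `wa = w`, `wb = 0`, and maximum weight bases for these weights. -/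
def startUp (w : α → ℝ) (tie : ℕ → Side → List α) : OracleProg α (State α) :=
  (maxWeightBase Side.a (tie 0 Side.a) w ∅).bind fun Sa =>
  (maxWeightBase Side.b (tie 0 Side.b) (fun _ => 0) ∅).bind fun Sb =>
  .ret { round := 0, p := fun _ => 0, wa := w, wb := fun _ => 0, Sa := Sa, Sb := Sb }

open Classical in
/-- The set of elements of `Sa \ Sb` adjusted fewer than `2 * ⌈1/ε⌉` times. -/
def adjustable (ε : ℝ) (s : State α) : Finset α :=
  (s.Sa \ s.Sb).filter (fun e => s.p e < 2 * ⌈ε⁻¹⌉₊)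

open Classical in
/-- The adjusted weights for the first matroid. -/
def newWa (w : α → ℝ) (ε : ℝ) (s : State α) (e : α) : ℝ :=
  if e ∈ adjustable ε s ∧ s.wa e + s.wb e ≠ w e
    then s.wa e - ε * (1 - ε) * w e else s.wa e

open Classical in
/-- The adjusted weights for the second matroid. -/
def newWb (w : α → ℝ) (ε : ℝ) (s : State α) (e : α) : ℝ :=
  if e ∈ adjustable ε s ∧ s.wa e + s.wb e = w e
    then s.wb e + ε * (1 - ε) * w e else s.wb e

open Classical in
/-- The adjusted counters. -/
def newP (ε : ℝ) (s : State α) (e : α) : ℕ :=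
  if e ∈ adjustable ε s then s.p e + 1 else s.p e

open Classical in
/-- One pass through the body of the while loop. -/
def loopBody [Fintype α] (w : α → ℝ) (ε : ℝ) (tie : ℕ → Side → List α) (s : State α) :
    OracleProg α (State α ⊕ Finset α) :=
  if ((adjustable ε s).card : ℝ) ≤ ε * (Fintype.card α : ℝ) then
    .ret (Sum.inr (s.Sa ∩ s.Sb))
  else
    (maxWeightBase Side.a (tie (s.round + 1) Side.a) (newWa w ε s) s.Sa).bind fun Sa =>
    (maxWeightBase Side.b (tie (s.round + 1) Side.b) (newWb w ε s) s.Sb).bind fun Sb =>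
    .ret (Sum.inl { round := s.round + 1, p := newP ε s, wa := newWa w ε s, wb := newWb w ε s,
                    Sa := Sa, Sb := Sb })

/-- The auction algorithm on the matroids `Ma`, `Mb` with weights `w`, parameter `ε` and residual
tie-breaking `tie` (round `k` uses the enumeration `tie k i` for the matroid `i`) terminates and
returns `S`, having asked `q` independence queries in total. -/
def AuctionReturns [Fintype α] (Ma Mb : Matroid α) (w : α → ℝ) (ε : ℝ)
    (tie : ℕ → Side → List α) (S : Finset α) (q : ℕ) : Prop :=
  ∃ (s : State α) (q₀ q₁ : ℕ),
    (startUp w tie).run (indepOracle Ma Mb) = (s, q₀) ∧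
    WhileRuns (indepOracle Ma Mb) (loopBody w ε tie) s S q₁ ∧
    q = q₀ + q₁

end

end AuctionMI

/-! The split weights are an approximate dual certificate. Adjustments of an element alternate
between raising `wb` and lowering `wa`, so `wa + wb` exceeds `w` by at most one adjustment, of size
at most `ε * W`. For a common independent `T` this gives `w(T) ≤ wa(T) + wb(T) ≤ wa(Sa) + wb(Sb)`,
by optimality of the two bases (`GreedyOptimal.sum_le_sum`).

It remains to compare the right side with the weight of `S = Sa ∩ Sb`. Old-base-first tie-breaking
ensures that an adjusted element of `Sb` lies in `Sa` (`Invariant.nextState`), so `wb` vanishes on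
`Sb \ Sa`. On `Sa \ Sb`, exhausted elements have `wa ≤ ε * W`, and the at most `ε * n` others cost
at most `W` each. Since `S` and `Sa \ Sb` partition `Sa`, the total loss is at most `2 * ε * W * n`
when `ε ≤ 1` (`Invariant.sum_le`); larger `ε` is trivial.

Each non-final iteration spends `2 * n` queries and uses up more than `ε * n` of the `2 * ⌈1/ε⌉ * n`
possible adjustments, which gives termination and the query bound. -/

namespace AuctionMI

noncomputable section

variable {α : Type*}

/-! ### Greedy bases and their query cost -/

/-- `Pref u old x y`: the greedy algorithm may process `x` before `y`. -/
def Pref (u : α → ℝ) (old : Finset α) (x y : α) : Prop :=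
  u y < u x ∨ (u x = u y ∧ (y ∈ old → x ∈ old))

lemma Pref.le {u : α → ℝ} {old : Finset α} {x y : α} (h : Pref u old x y) : u y ≤ u x := by
  rcases h with h | h
  · exact h.le
  · exact h.1.ge

/-- `S` is independent and every element outside `S` is spanned by elements of `S` which are
preferred to it. -/
def GreedyOptimal (M : Matroid α) (r : α → α → Prop) (S : Finset α) : Prop :=
  M.Indep (S : Set α) ∧ ∀ e ∉ S, e ∈ M.closure {f | f ∈ S ∧ r f e}

lemma GreedyOptimal.mono {M : Matroid α} {r r' : α → α → Prop} {S : Finset α}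
    (h : GreedyOptimal M r S) (hr : ∀ x y, r x y → r' x y) : GreedyOptimal M r' S :=
  by
  refine ⟨h.1, fun e he => M.closure_subset_closure ?_ (h.2 e he)⟩
  exact fun f hf => ⟨hf.1, hr _ _ hf.2⟩

lemma pairwise_greedyOrder (tie : List α) (u : α → ℝ) (old : Finset α) :
    (greedyOrder tie u old).Pairwise (Pref u old) := by
  classical
  have h := List.pairwise_mergeSort
    (le := fun x y => decide (u y < u x ∨ (u x = u y ∧ (y ∈ old → x ∈ old))))
    (fun a b c hab hbc => by
      simp only [decide_eq_true_eq] at *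
      rcases hab with hab | ⟨hab, hab'⟩ <;> rcases hbc with hbc | ⟨hbc, hbc'⟩
      · exact Or.inl (hbc.trans hab)
      · exact Or.inl (hbc.symm.trans_lt hab)
      · exact Or.inl (hbc.trans_eq hab.symm)
      · exact Or.inr ⟨hab.trans hbc, fun h => hab' (hbc' h)⟩)
    (fun a b => by
      simp only [Bool.or_eq_true, decide_eq_true_eq]
      rcases lt_trichotomy (u a) (u b) with h | h | h
      · exact Or.inr (Or.inl h)
      · by_cases ha : a ∈ old
        · exact Or.inl (Or.inr ⟨h, fun _ => ha⟩)
        · exact Or.inr (Or.inr ⟨h.symm, fun h => absurd h ha⟩)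
      · exact Or.inl (Or.inl h))
    tie
  simp only [decide_eq_true_eq] at h
  exact h

lemma OracleProg.run_bind {β γ : Type*} (O : Side → Finset α → Bool) (P : OracleProg α β)
    (f : β → OracleProg α γ) :
    (P.bind f).run O =
      (((f (P.run O).1).run O).1, (P.run O).2 + ((f (P.run O).1).run O).2) := by
  induction P with
  | ret x => simp [OracleProg.bind, OracleProg.run]
  | ask i T k ih =>
    simp only [OracleProg.bind, OracleProg.run, ih]
    ext <;> simp
    omega

lemma run_greedy_snd (O : Side → Finset α → Bool) (i : Side) (l : List α) (S : Finset α) :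
    ((greedy i l S).run O).2 = l.length := by
  induction l generalizing S with
  | nil => rfl
  | cons e l ih => simp [greedy, OracleProg.run, ih]

/-- The matroid belonging to a side. -/
def matroidOf (Ma Mb : Matroid α) : Side → Matroid α
  | Side.a => Ma
  | Side.b => Mb

open Classical in
lemma indepOracle_eq (Ma Mb : Matroid α) (i : Side) (T : Finset α) :
    indepOracle Ma Mb i T = decide ((matroidOf Ma Mb i).Indep (T : Set α)) := by
  cases i <;> rfl

/-- A rejected element is spanned by the set held at that moment, whose members lie in the starting
set `S` or came earlier in the list. The set only grows afterwards, so the spanning persists. -/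
lemma run_greedy_fst (Ma Mb : Matroid α) (i : Side) (hE : (matroidOf Ma Mb i).E = Set.univ)
    (r : α → α → Prop) (l : List α) (hl : l.Pairwise r) (S : Finset α)
    (hS : (matroidOf Ma Mb i).Indep (S : Set α)) :
    S ⊆ ((greedy i l S).run (indepOracle Ma Mb)).1 ∧
    (matroidOf Ma Mb i).Indep (((greedy i l S).run (indepOracle Ma Mb)).1 : Set α) ∧
    ∀ e ∈ l, e ∉ ((greedy i l S).run (indepOracle Ma Mb)).1 →
      e ∈ (matroidOf Ma Mb i).closure
        {f | f ∈ ((greedy i l S).run (indepOracle Ma Mb)).1 ∧ (f ∈ S ∨ r f e)} := by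
  classical
  induction l generalizing S with
  | nil => exact ⟨Finset.Subset.refl _, hS, by simp⟩
  | cons e l ih =>
    rw [List.pairwise_cons] at hl
    simp only [greedy, OracleProg.run, indepOracle_eq, decide_eq_true_eq]
    by_cases h : (matroidOf Ma Mb i).Indep ((insert e S : Finset α) : Set α)
    · obtain ⟨h1, h2, h3⟩ := ih hl.2 (insert e S) h
      rw [if_pos h]
      refine ⟨(Finset.subset_insert _ _).trans h1, h2, fun x hx hxR => ?_⟩
      rcases List.mem_cons.1 hx with rfl | hxl
      · exact absurd (h1 (Finset.mem_insert_self _ _)) hxR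
      · refine Matroid.closure_subset_closure _ ?_ (h3 x hxl hxR)
        refine fun f hf => ⟨hf.1, ?_⟩
        rcases hf.2 with hf' | hf'
        · rcases Finset.mem_insert.1 hf' with rfl | hf'
          · exact Or.inr (hl.1 x hxl)
          · exact Or.inl hf'
        · exact Or.inr hf'
    · obtain ⟨h1, h2, h3⟩ := ih hl.2 S hS
      rw [if_neg h]
      refine ⟨h1, h2, fun x hx hxR => ?_⟩
      rcases List.mem_cons.1 hx with rfl | hx
      · have hx : x ∈ (matroidOf Ma Mb i).closure (S : Set α) := by
          rw [hS.mem_closure_iff_of_notMem (fun hxS => hxR (h1 hxS)),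
            Matroid.dep_iff, hE, ← Finset.coe_insert]
          exact ⟨h, Set.subset_univ _⟩
        refine Matroid.closure_subset_closure _ ?_ hx
        exact fun f hf => ⟨h1 hf, Or.inl hf⟩
      · exact h3 x hx hxR

lemma greedyOptimal_maxWeightBase {Ma Mb : Matroid α} {i : Side}
    (hE : (matroidOf Ma Mb i).E = Set.univ) {tie : List α} (htie : ∀ e, e ∈ tie)
    (u : α → ℝ) (old : Finset α) :
    GreedyOptimal (matroidOf Ma Mb i) (Pref u old)
      ((maxWeightBase i tie u old).run (indepOracle Ma Mb)).1 := by
  obtain ⟨-, h2, h3⟩ := run_greedy_fst Ma Mb i hE _ _ (pairwise_greedyOrder tie u old) ∅ (by simp)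
  refine ⟨h2, fun e he => ?_⟩
  have h := h3 e (by simp [greedyOrder, htie]) he
  simpa [maxWeightBase] using h

lemma run_maxWeightBase_snd [Fintype α] (O : Side → Finset α → Bool) (i : Side) {tie : List α}
    (htie : tie.Nodup ∧ ∀ e, e ∈ tie) (u : α → ℝ) (old : Finset α) :
    ((maxWeightBase i tie u old).run O).2 = Fintype.card α := by
  classical
  rw [maxWeightBase, run_greedy_snd, greedyOrder, List.length_mergeSort,
    ← List.toFinset_card_of_nodup htie.1, ← Finset.card_univ]
  congr 1
  ext e
  simp [htie.2 e]

/-! ### Stability of greedy bases under weight changes -/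

/-- If only weights of elements outside the old base increase, then new elements of the base have
a changed weight. -/
lemma GreedyOptimal.notMem_of_raise {M : Matroid α} {u u' : α → ℝ} {S S' : Finset α}
    (hE : M.E = Set.univ)
    (hS : GreedyOptimal M (fun f e => u e ≤ u f) S) (hS' : GreedyOptimal M (Pref u' S) S')
    (hu : ∀ f ∈ S, u f ≤ u' f) {e : α} (he : e ∉ S) (hue : u' e = u e) : e ∉ S' := by
  intro heS'
  -- Contradiction sought: `e` is spanned by `S' \ {e}`. It is spanned by the `f ∈ S` at least as
  -- heavy, and each such `f` is spanned without `e`, because `e` is not preferred to `f`: `f` is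
  -- still at least as heavy and wins ties as a member of `S`.
  refine hS'.1.notMem_closure_sdiff_of_mem heS' ?_
  refine M.closure_subset_closure_of_subset_closure ?_ (hS.2 e he)
  rintro f ⟨hf, hef⟩
  by_cases hfS' : f ∈ S'
  · refine M.mem_closure_of_mem' ⟨hfS', ?_⟩ (by simp [hE])
    rintro rfl
    exact he hf
  · refine M.closure_subset_closure ?_ (hS'.2 f hfS')
    rintro g ⟨hg, hgf⟩
    refine ⟨hg, ?_⟩
    rintro rfl
    rcases hgf with h | h
    · have := hu f hf
      linarith
    · exact he (h.2 hf)

/-- If weights only decrease, then elements of the base with unchanged weight remain. -/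
lemma GreedyOptimal.mem_of_lower {M : Matroid α} {u u' : α → ℝ} {S S' : Finset α}
    (hE : M.E = Set.univ)
    (hS : GreedyOptimal M (fun f e => u e ≤ u f) S) (hS' : GreedyOptimal M (Pref u' S) S')
    (hu : ∀ f, u' f ≤ u f) {e : α} (he : e ∈ S) (hue : u' e = u e) : e ∈ S' := by
  by_contra heS'
  -- Same exchange with the bases swapped: an `f ∉ S` preferred to `e ∈ S` must be strictly heavier,
  -- so the elements of `S` spanning `f` do not include `e`.
  refine hS.1.notMem_closure_sdiff_of_mem he ?_
  refine M.closure_subset_closure_of_subset_closure ?_ (hS'.2 e heS')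
  rintro f ⟨hf, hfe⟩
  by_cases hfS : f ∈ S
  · refine M.mem_closure_of_mem' ⟨hfS, ?_⟩ (by simp [hE])
    rintro rfl
    exact heS' hf
  · refine M.closure_subset_closure ?_ (hS.2 f hfS)
    rintro g ⟨hg, hgf⟩
    refine ⟨hg, ?_⟩
    rintro rfl
    rcases hfe with h | h
    · have := hu f
      linarith
    · exact hfS (h.2 he)

/-! ### Greedy bases have maximum weight -/

/-- Match a heaviest `t ∈ T` with some `s ∈ S` at least as heavy and delete both: superlevel counts
at `c ≤ u t` each drop by one, and above `u t` those of `T` are zero. -/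
lemma sum_le_sum_of_card_superlevel_le {u : α → ℝ} (hu : ∀ e, 0 ≤ u e) (T : Finset α) :
    ∀ S : Finset α, (∀ c : ℝ, (T.filter (fun e => c ≤ u e)).card ≤
      (S.filter (fun e => c ≤ u e)).card) → ∑ e ∈ T, u e ≤ ∑ e ∈ S, u e := by
  classical
  induction hn : T.card generalizing T with
  | zero =>
    intro S _
    rw [Finset.card_eq_zero.1 hn]
    simpa using Finset.sum_nonneg fun e _ => hu e
  | succ n ih =>
    intro S h
    have hT : T.Nonempty := Finset.card_pos.1 (by omega)
    obtain ⟨t, ht, htmax⟩ := T.exists_max_image u hT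
    have hS : (S.filter (fun e => u t ≤ u e)).Nonempty := by
      refine Finset.card_pos.1 (lt_of_lt_of_le (Finset.card_pos.2 ⟨t, ?_⟩) (h (u t)))
      simp [ht]
    obtain ⟨s, hs⟩ := hS
    rw [Finset.mem_filter] at hs
    have key := ih (T.erase t) (by rw [Finset.card_erase_of_mem ht, hn]; rfl) (S.erase s) ?_
    · rw [← Finset.add_sum_erase T u ht, ← Finset.add_sum_erase S u hs.1]
      linarith [hs.2]
    · intro c
      rw [Finset.filter_erase, Finset.filter_erase]
      by_cases hc : c ≤ u t
      · rw [Finset.card_erase_of_mem (by simp [ht, hc]),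
          Finset.card_erase_of_mem (by simp [hs.1, hc.trans hs.2])]
        exact Nat.sub_le_sub_right (h c) 1
      · have : T.filter (fun e => c ≤ u e) = ∅ := by
          refine Finset.filter_eq_empty_iff.2 fun x hx hcx => hc (hcx.trans (htmax x hx))
        simp [this]

/-- A greedily computed set has maximum weight among all independent sets. -/
lemma GreedyOptimal.sum_le_sum {M : Matroid α} {u : α → ℝ} {S : Finset α} (hE : M.E = Set.univ)
    (hS : GreedyOptimal M (fun f e => u e ≤ u f) S) (hu : ∀ e, 0 ≤ u e) {T : Finset α}
    (hT : M.Indep (T : Set α)) : ∑ e ∈ T, u e ≤ ∑ e ∈ S, u e := by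
  refine sum_le_sum_of_card_superlevel_le hu T S fun c => ?_
  -- The heavy part of `S` spans every element of weight at least `c`, so comparing ranks yields the
  -- superlevel counts.
  have hsub : ((T.filter (fun e => c ≤ u e) : Finset α) : Set α) ⊆
      M.closure ((S.filter (fun e => c ≤ u e) : Finset α) : Set α) := by
    intro t ht
    simp only [Finset.coe_filter, Set.mem_ofPred_eq] at ht ⊢
    by_cases htS : t ∈ S
    · exact M.mem_closure_of_mem' ⟨htS, ht.2⟩ (by simp [hE])
    · refine M.closure_subset_closure ?_ (hS.2 t htS)
      exact fun f hf => ⟨hf.1, ht.2.trans hf.2⟩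
  have hTc : M.Indep ((T.filter (fun e => c ≤ u e) : Finset α) : Set α) :=
    hT.subset (Finset.coe_subset.2 (Finset.filter_subset _ _))
  have h := M.eRk_mono hsub
  rw [hTc.eRk_eq_encard, M.eRk_closure_eq] at h
  have h' := h.trans (M.eRk_le_encard _)
  simpa only [Set.encard_coe_eq_coe_finsetCard, Nat.cast_le] using h'

/-! ### The loop invariant and its preservation -/

/-- The size of a weight adjustment. -/
def adjustment (w : α → ℝ) (ε : ℝ) (e : α) : ℝ := ε * (1 - ε) * w e

/-- The invariant of the auction algorithm. -/
structure Invariant (Ma Mb : Matroid α) (w : α → ℝ) (ε : ℝ) (s : State α) : Prop where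
  optimal_a : GreedyOptimal Ma (fun f e => s.wa e ≤ s.wa f) s.Sa
  optimal_b : GreedyOptimal Mb (fun f e => s.wb e ≤ s.wb f) s.Sb
  p_le : ∀ e, s.p e ≤ 2 * ⌈ε⁻¹⌉₊
  wa_eq : ∀ e, s.wa e = w e - ((s.p e / 2 : ℕ) : ℝ) * adjustment w ε e
  wb_eq : ∀ e, s.wb e = (((s.p e + 1) / 2 : ℕ) : ℝ) * adjustment w ε e
  mem_of_adjusted : ∀ e, 1 ≤ s.p e → e ∈ s.Sb → e ∈ s.Sa

lemma invariant_startUp {Ma Mb : Matroid α} (ha : Ma.E = Set.univ) (hb : Mb.E = Set.univ)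
    (w : α → ℝ) (ε : ℝ) {tie : ℕ → Side → List α} (htie : ∀ k i, ∀ e, e ∈ tie k i) :
    Invariant Ma Mb w ε ((startUp w tie).run (indepOracle Ma Mb)).1 := by
  simp only [startUp, OracleProg.run_bind, OracleProg.run]
  exact
    { optimal_a := (greedyOptimal_maxWeightBase (i := Side.a) ha (htie _ _) _ _).mono
        fun _ _ h => h.le
      optimal_b := (greedyOptimal_maxWeightBase (i := Side.b) hb (htie _ _) _ _).mono
        fun _ _ h => h.le
      p_le := by simp
      wa_eq := by simp
      wb_eq := by simp
      mem_of_adjusted := by simp }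

lemma p_startUp (O : Side → Finset α → Bool) (w : α → ℝ) (tie : ℕ → Side → List α) :
    ((startUp w tie).run O).1.p = fun _ => 0 := by
  simp only [startUp, OracleProg.run_bind, OracleProg.run]

lemma run_startUp_snd [Fintype α] (O : Side → Finset α → Bool) (w : α → ℝ)
    {tie : ℕ → Side → List α} (htie : ∀ k i, (tie k i).Nodup ∧ ∀ e, e ∈ tie k i) :
    ((startUp w tie).run O).2 = 2 * Fintype.card α := by
  simp only [startUp, OracleProg.run_bind, OracleProg.run,
    run_maxWeightBase_snd _ _ (htie _ _)]
  ring

/-- The state after an iteration of the loop that does not return. -/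
def nextState (O : Side → Finset α → Bool) (w : α → ℝ) (ε : ℝ) (tie : ℕ → Side → List α)
    (s : State α) : State α :=
  { round := s.round + 1
    p := newP ε s
    wa := newWa w ε s
    wb := newWb w ε s
    Sa := ((maxWeightBase Side.a (tie (s.round + 1) Side.a) (newWa w ε s) s.Sa).run O).1
    Sb := ((maxWeightBase Side.b (tie (s.round + 1) Side.b) (newWb w ε s) s.Sb).run O).1 }

open Classical in
lemma run_loopBody_of_le [Fintype α] (O : Side → Finset α → Bool) (w : α → ℝ) {ε : ℝ}
    (tie : ℕ → Side → List α) {s : State α}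
    (h : ((adjustable ε s).card : ℝ) ≤ ε * (Fintype.card α : ℝ)) :
    (loopBody w ε tie s).run O = (Sum.inr (s.Sa ∩ s.Sb), 0) := by
  rw [loopBody, if_pos h, OracleProg.run]

lemma run_loopBody_of_lt [Fintype α] (O : Side → Finset α → Bool) (w : α → ℝ) {ε : ℝ}
    {tie : ℕ → Side → List α} (htie : ∀ k i, (tie k i).Nodup ∧ ∀ e, e ∈ tie k i) {s : State α}
    (h : ε * (Fintype.card α : ℝ) < ((adjustable ε s).card : ℝ)) :
    (loopBody w ε tie s).run O = (Sum.inl (nextState O w ε tie s), 2 * Fintype.card α) := by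
  rw [loopBody, if_neg (not_le.2 h)]
  simp only [OracleProg.run_bind, OracleProg.run, run_maxWeightBase_snd _ _ (htie _ _), nextState]
  congr 1
  ring

lemma mem_adjustable {ε : ℝ} {s : State α} {e : α} :
    e ∈ adjustable ε s ↔ (e ∈ s.Sa ∧ e ∉ s.Sb) ∧ s.p e < 2 * ⌈ε⁻¹⌉₊ := by
  simp [adjustable]

/-- The delicate field is `mem_of_adjusted`. An element enters `Sb` only when its `wb` is raised;
its `wa` is then unchanged, so it stays in `Sa`. -/
lemma Invariant.nextState {Ma Mb : Matroid α} (ha : Ma.E = Set.univ) (hb : Mb.E = Set.univ)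
    {w : α → ℝ} (hw : ∀ e, 0 ≤ w e) {ε : ℝ} (hε : 0 < ε) (hε1 : ε ≤ 1)
    {tie : ℕ → Side → List α} (htie : ∀ k i, ∀ e, e ∈ tie k i) {s : State α}
    (hs : Invariant Ma Mb w ε s) :
    Invariant Ma Mb w ε (nextState (indepOracle Ma Mb) w ε tie s) := by
  have hδ : ∀ e, 0 ≤ adjustment w ε e := fun e =>
    mul_nonneg (mul_nonneg hε.le (sub_nonneg.2 hε1)) (hw e)
  have hSa := greedyOptimal_maxWeightBase (i := Side.a) (Ma := Ma) (Mb := Mb) ha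
    (htie (s.round + 1) Side.a) (newWa w ε s) s.Sa
  have hSb := greedyOptimal_maxWeightBase (i := Side.b) (Ma := Ma) (Mb := Mb) hb
    (htie (s.round + 1) Side.b) (newWb w ε s) s.Sb
  -- The algorithm's test reads off the parity of `p e`. It fails to do so only for zero
  -- adjustments, where the formulas for `wa` and `wb` do not depend on `p`.
  have hsum : ∀ e, s.wa e + s.wb e = w e ↔ (s.p e % 2 = 0 ∨ adjustment w ε e = 0) := by
    intro e
    rw [hs.wa_eq, hs.wb_eq]
    rcases Nat.mod_two_eq_zero_or_one (s.p e) with h | h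
    · have : (s.p e + 1) / 2 = s.p e / 2 := by omega
      simp [this, h]
    · have : (s.p e + 1) / 2 = s.p e / 2 + 1 := by omega
      rw [this]
      push_cast
      simp only [h, one_ne_zero, false_or]
      constructor <;> intro h' <;> linarith
  have hlower : ∀ e, newWa w ε s e ≤ s.wa e := by
    intro e
    unfold newWa
    split_ifs
    · exact sub_le_self _ (hδ e)
    · exact le_rfl
  have hraise : ∀ e, s.wb e ≤ newWb w ε s e := by
    intro e
    unfold newWb
    split_ifs
    · exact le_add_of_nonneg_right (hδ e)
    · exact le_rfl
  refine ⟨hSa.mono fun _ _ h => h.le, hSb.mono fun _ _ h => h.le, ?_, ?_, ?_, ?_⟩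
  · intro e
    simp only [AuctionMI.nextState, newP]
    split_ifs with h
    · exact (mem_adjustable.1 h).2
    · exact hs.p_le e
  · intro e
    simp only [AuctionMI.nextState, newP, newWa]
    by_cases h : e ∈ adjustable ε s
    · by_cases h0 : adjustment w ε e = 0
      · have h1 := hs.wa_eq e
        have h2 : ε * (1 - ε) * w e = 0 := h0
        simp [h0, h2] at h1 ⊢
        exact h1
      · have h1 := hsum e
        simp only [h0, or_false] at h1
        simp only [h, true_and, if_true, Ne, h1]
        rw [hs.wa_eq]
        split_ifs with h2
        · have : (s.p e + 1) / 2 = s.p e / 2 := by omega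
          rw [this]
        · have : (s.p e + 1) / 2 = s.p e / 2 + 1 := by omega
          rw [this]
          push_cast
          unfold adjustment
          ring
    · simp only [h, false_and, if_false]
      exact hs.wa_eq e
  · intro e
    simp only [AuctionMI.nextState, newP, newWb]
    by_cases h : e ∈ adjustable ε s
    · by_cases h0 : adjustment w ε e = 0
      · have h1 := hs.wb_eq e
        have h2 : ε * (1 - ε) * w e = 0 := h0
        simp [h0, h2] at h1 ⊢
        exact h1
      · have h1 := hsum e
        simp only [h0, or_false] at h1
        simp only [h, true_and, if_true, h1]
        rw [hs.wb_eq]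
        split_ifs with h2
        · have : (s.p e + 1 + 1) / 2 = (s.p e + 1) / 2 + 1 := by omega
          rw [this]
          push_cast
          unfold adjustment
          ring
        · have : (s.p e + 1 + 1) / 2 = (s.p e + 1) / 2 := by omega
          rw [this]
    · simp only [h, false_and, if_false]
      exact hs.wb_eq e
  · intro e hp heb
    have memSb : newWb w ε s e = s.wb e → e ∈ s.Sb := fun h => by
      by_contra hne
      exact hs.optimal_b.notMem_of_raise hb hSb (fun f _ => hraise f) hne h heb
    have memSa : e ∈ s.Sa → newWa w ε s e = s.wa e →
        e ∈ (AuctionMI.nextState (indepOracle Ma Mb) w ε tie s).Sa :=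
      fun h h' => hs.optimal_a.mem_of_lower ha hSa hlower h h'
    by_cases h : e ∈ adjustable ε s
    · by_cases h' : s.wa e + s.wb e = w e
      · exact memSa (mem_adjustable.1 h).1.1 (by simp [newWa, h'])
      -- Here only `wa` is lowered; `wb` is unchanged, so `e` cannot have entered `Sb`.
      · exact absurd (memSb (by simp [newWb, h'])) (mem_adjustable.1 h).1.2
    · have hp' : 1 ≤ s.p e := by simpa [AuctionMI.nextState, newP, h] using hp
      exact memSa (hs.mem_of_adjusted e hp' (memSb (by simp [newWb, h]))) (by simp [newWa, h])

/-! ### Termination and query count -/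

/-- The number of adjustments that are still possible. -/
def potential [Fintype α] (ε : ℝ) (s : State α) : ℕ := ∑ e, (2 * ⌈ε⁻¹⌉₊ - s.p e)

lemma potential_nextState [Fintype α] (O : Side → Finset α → Bool) (w : α → ℝ) (ε : ℝ)
    (tie : ℕ → Side → List α) (s : State α) :
    potential ε (nextState O w ε tie s) + (adjustable ε s).card = potential ε s := by
  classical
  have hc : (adjustable ε s).card = ∑ e, if e ∈ adjustable ε s then 1 else 0 := by simp
  rw [hc, potential, potential, ← Finset.sum_add_distrib]
  refine Finset.sum_congr rfl fun e _ => ?_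
  simp only [nextState, newP]
  split_ifs with h
  · have := (mem_adjustable.1 h).2
    omega
  · rfl

/-- For `ε ≥ 1` the loop returns at once, so preservation of the invariant may assume `ε ≤ 1`
whenever an iteration takes place. -/
lemma lt_one_of_lt_card [Fintype α] {ε : ℝ} {X : Finset α}
    (h : ε * (Fintype.card α : ℝ) < (X.card : ℝ)) : ε < 1 := by
  have h1 : (X.card : ℝ) ≤ Fintype.card α := by exact_mod_cast X.card_le_univ
  by_contra hε
  have := mul_le_mul_of_nonneg_right (not_lt.1 hε) (Nat.cast_nonneg (α := ℝ) (Fintype.card α))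
  linarith

lemma exists_whileRuns [Fintype α] (O : Side → Finset α → Bool) (w : α → ℝ) {ε : ℝ} (hε : 0 < ε)
    {tie : ℕ → Side → List α} (htie : ∀ k i, (tie k i).Nodup ∧ ∀ e, e ∈ tie k i) (s : State α) :
    ∃ S q, WhileRuns O (loopBody w ε tie) s S q := by
  induction hn : potential ε s using Nat.strong_induction_on generalizing s with
  | _ n ih =>
    by_cases h : ((adjustable ε s).card : ℝ) ≤ ε * (Fintype.card α : ℝ)
    · exact ⟨_, _, .done (run_loopBody_of_le O w tie h)⟩
    · have hlt := not_le.1 h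
      have hpos : 0 < (adjustable ε s).card := by
        have : (0 : ℝ) < (adjustable ε s).card := lt_of_le_of_lt (by positivity) hlt
        exact_mod_cast this
      have hpot := potential_nextState O w ε tie s
      obtain ⟨S, q, hr⟩ := ih _ (by omega) (nextState O w ε tie s) rfl
      exact ⟨S, _, .step (run_loopBody_of_lt O w htie hlt) hr⟩

/-- A terminating run of the loop returns from a state satisfying the invariant, and its number of
queries is bounded by the potential. -/
lemma WhileRuns.exists_final [Fintype α] {Ma Mb : Matroid α} (ha : Ma.E = Set.univ)
    (hb : Mb.E = Set.univ) {w : α → ℝ} (hw : ∀ e, 0 ≤ w e) {ε : ℝ} (hε : 0 < ε)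
    {tie : ℕ → Side → List α} (htie : ∀ k i, (tie k i).Nodup ∧ ∀ e, e ∈ tie k i)
    {s : State α} {S : Finset α} {q : ℕ}
    (h : WhileRuns (indepOracle Ma Mb) (loopBody w ε tie) s S q) (hs : Invariant Ma Mb w ε s) :
    (∃ t : State α, Invariant Ma Mb w ε t ∧
      ((adjustable ε t).card : ℝ) ≤ ε * (Fintype.card α : ℝ) ∧
      (∀ e, e ∈ S ↔ e ∈ t.Sa ∧ e ∈ t.Sb)) ∧
    ε * (q : ℝ) ≤ 2 * (potential ε s : ℝ) := by
  classical
  induction h with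
  | @done s x q h =>
    by_cases hc : ((adjustable ε s).card : ℝ) ≤ ε * (Fintype.card α : ℝ)
    · rw [run_loopBody_of_le _ w tie hc, Prod.mk.injEq, Sum.inr.injEq] at h
      obtain ⟨rfl, rfl⟩ := h
      exact ⟨⟨s, hs, hc, fun e => by simp⟩, by simp⟩
    · rw [run_loopBody_of_lt _ w htie (not_le.1 hc)] at h
      simp at h
  | @step s s' x q q' h h' ih =>
    by_cases hc : ((adjustable ε s).card : ℝ) ≤ ε * (Fintype.card α : ℝ)
    · rw [run_loopBody_of_le _ w tie hc] at h
      simp at h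
    · have hlt := not_le.1 hc
      rw [run_loopBody_of_lt _ w htie hlt, Prod.mk.injEq, Sum.inl.injEq] at h
      obtain ⟨rfl, rfl⟩ := h
      obtain ⟨ht, hq⟩ := ih (hs.nextState ha hb hw hε (lt_one_of_lt_card hlt).le
        fun k i => (htie k i).2)
      refine ⟨ht, ?_⟩
      -- The `2 * n` queries of this iteration, times `ε`, are paid for by twice the number of
      -- adjusted elements, which is the drop in potential.
      have hpot : (potential ε (nextState (indepOracle Ma Mb) w ε tie s) : ℝ) +
          (adjustable ε s).card = potential ε s := by
        exact_mod_cast potential_nextState (indepOracle Ma Mb) w ε tie s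
      push_cast
      linarith

/-! ### Approximation guarantee -/

/-- The factor `1 - ε` absorbs the rounding: `⌈1/ε⌉ * ε * (1 - ε) ≤ (1 + ε) * (1 - ε) ≤ 1`. This
keeps `wa` nonnegative. -/
lemma natCeil_mul_adjustment_le {w : α → ℝ} {ε : ℝ} (hε : 0 < ε) (hε1 : ε ≤ 1) {e : α}
    (hw : 0 ≤ w e) : (⌈ε⁻¹⌉₊ : ℝ) * adjustment w ε e ≤ w e := by
  have h1 : (⌈ε⁻¹⌉₊ : ℝ) < ε⁻¹ + 1 := Nat.ceil_lt_add_one (by positivity)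
  have h2 : (⌈ε⁻¹⌉₊ : ℝ) * ε ≤ 1 + ε := by
    have := mul_le_mul_of_nonneg_right h1.le hε.le
    rwa [add_mul, inv_mul_cancel₀ hε.ne', one_mul] at this
  have h3 : (⌈ε⁻¹⌉₊ : ℝ) * ε * (1 - ε) ≤ 1 := by
    have := mul_le_mul_of_nonneg_right h2 (sub_nonneg.2 hε1)
    nlinarith
  calc (⌈ε⁻¹⌉₊ : ℝ) * adjustment w ε e = (⌈ε⁻¹⌉₊ : ℝ) * ε * (1 - ε) * w e := by
        unfold adjustment; ring
    _ ≤ 1 * w e := mul_le_mul_of_nonneg_right h3 hw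
    _ = w e := one_mul _

/-- Guarantees that an exhausted element retains at most `ε * w e` of its `wa`. -/
lemma le_natCeil_mul_adjustment {w : α → ℝ} {ε : ℝ} (hε : 0 < ε) (hε1 : ε ≤ 1) {e : α}
    (hw : 0 ≤ w e) : (1 - ε) * w e ≤ (⌈ε⁻¹⌉₊ : ℝ) * adjustment w ε e := by
  have h1 : ε⁻¹ ≤ (⌈ε⁻¹⌉₊ : ℝ) := Nat.le_ceil _
  have h2 : 1 ≤ (⌈ε⁻¹⌉₊ : ℝ) * ε := by
    have := mul_le_mul_of_nonneg_right h1 hε.le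
    rwa [inv_mul_cancel₀ hε.ne'] at this
  calc (1 - ε) * w e = 1 * ((1 - ε) * w e) := (one_mul _).symm
    _ ≤ (⌈ε⁻¹⌉₊ : ℝ) * ε * ((1 - ε) * w e) :=
        mul_le_mul_of_nonneg_right h2 (mul_nonneg (sub_nonneg.2 hε1) hw)
    _ = _ := by unfold adjustment; ring

/-- The common independent set of a final state is nearly optimal. -/
lemma Invariant.sum_le [Fintype α] {Ma Mb : Matroid α} (ha : Ma.E = Set.univ)
    (hb : Mb.E = Set.univ) {w : α → ℝ} {W : ℝ} (hw : ∀ e, 0 ≤ w e) (hW : ∀ e, w e ≤ W)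
    {ε : ℝ} (hε : 0 < ε) (hε1 : ε ≤ 1) {t : State α} (ht : Invariant Ma Mb w ε t)
    (hc : ((adjustable ε t).card : ℝ) ≤ ε * (Fintype.card α : ℝ))
    {S T : Finset α} (hS : ∀ e, e ∈ S ↔ e ∈ t.Sa ∧ e ∈ t.Sb)
    (hTa : Ma.Indep (T : Set α)) (hTb : Mb.Indep (T : Set α)) :
    ∑ e ∈ T, w e ≤ ∑ e ∈ S, w e + 2 * ε * W * (Fintype.card α : ℝ) := by
  classical
  have hδ : ∀ e, 0 ≤ adjustment w ε e := fun e =>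
    mul_nonneg (mul_nonneg hε.le (sub_nonneg.2 hε1)) (hw e)
  have hδle : ∀ e, adjustment w ε e ≤ ε * W := fun e => by
    have : ε * (1 - ε) ≤ ε := by nlinarith
    exact (mul_le_mul_of_nonneg_right this (hw e)).trans (mul_le_mul_of_nonneg_left (hW e) hε.le)
  have hwa : ∀ e, 0 ≤ t.wa e := by
    intro e
    rw [ht.wa_eq, sub_nonneg]
    refine le_trans (mul_le_mul_of_nonneg_right ?_ (hδ e)) (natCeil_mul_adjustment_le hε hε1 (hw e))
    have := ht.p_le e
    exact_mod_cast (by omega : t.p e / 2 ≤ ⌈ε⁻¹⌉₊)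
  have hwb : ∀ e, 0 ≤ t.wb e := by
    intro e
    rw [ht.wb_eq]
    exact mul_nonneg (Nat.cast_nonneg _) (hδ e)
  have hwa_le : ∀ e, t.wa e ≤ W := by
    intro e
    rw [ht.wa_eq]
    linarith [hW e, mul_nonneg (Nat.cast_nonneg (α := ℝ) (t.p e / 2)) (hδ e)]
  have hsum : ∀ e, w e ≤ t.wa e + t.wb e ∧ t.wa e + t.wb e ≤ w e + adjustment w ε e := by
    intro e
    rw [ht.wa_eq, ht.wb_eq]
    rcases Nat.mod_two_eq_zero_or_one (t.p e) with h | h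
    · have : (t.p e + 1) / 2 = t.p e / 2 := by omega
      rw [this]
      constructor <;> linarith [hδ e]
    · have : (t.p e + 1) / 2 = t.p e / 2 + 1 := by omega
      rw [this]
      push_cast
      constructor <;> linarith [hδ e]
  have hexh : ∀ e ∈ t.Sa \ t.Sb, e ∉ adjustable ε t → t.wa e ≤ ε * W := by
    intro e he hna
    rw [Finset.mem_sdiff] at he
    have hp : t.p e / 2 = ⌈ε⁻¹⌉₊ := by
      have h1 := ht.p_le e
      have h2 : ¬ t.p e < 2 * ⌈ε⁻¹⌉₊ := fun h => hna (mem_adjustable.2 ⟨he, h⟩)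
      omega
    rw [ht.wa_eq, hp]
    have := le_natCeil_mul_adjustment hε hε1 (hw e)
    have := mul_le_mul_of_nonneg_left (hW e) hε.le
    linarith
  have hSeq : S = t.Sa ∩ t.Sb := by ext e; simp [hS]
  have hwb0 : ∑ e ∈ t.Sb \ t.Sa, t.wb e = 0 := by
    refine Finset.sum_eq_zero fun e he => ?_
    rw [Finset.mem_sdiff] at he
    have hp : t.p e = 0 := by
      by_contra hp
      exact he.2 (ht.mem_of_adjusted e (Nat.one_le_iff_ne_zero.2 hp) he.1)
    rw [ht.wb_eq, hp]
    simp
  have hsplit_a : ∑ e ∈ t.Sa, t.wa e = ∑ e ∈ S, t.wa e + ∑ e ∈ t.Sa \ t.Sb, t.wa e := by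
    rw [hSeq, Finset.sum_inter_add_sum_sdiff]
  have hsplit_b : ∑ e ∈ t.Sb, t.wb e = ∑ e ∈ S, t.wb e + ∑ e ∈ t.Sb \ t.Sa, t.wb e := by
    rw [hSeq, Finset.inter_comm, Finset.sum_inter_add_sum_sdiff]
  have hTsum : ∑ e ∈ T, w e ≤ ∑ e ∈ t.Sa, t.wa e + ∑ e ∈ t.Sb, t.wb e := by
    calc ∑ e ∈ T, w e ≤ ∑ e ∈ T, (t.wa e + t.wb e) := Finset.sum_le_sum fun e _ => (hsum e).1
      _ = ∑ e ∈ T, t.wa e + ∑ e ∈ T, t.wb e := Finset.sum_add_distrib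
      _ ≤ _ := add_le_add (ht.optimal_a.sum_le_sum ha hwa hTa) (ht.optimal_b.sum_le_sum hb hwb hTb)
  have hScommon : ∑ e ∈ S, t.wa e + ∑ e ∈ S, t.wb e ≤ ∑ e ∈ S, w e + S.card * (ε * W) := by
    rw [← Finset.sum_add_distrib]
    calc ∑ e ∈ S, (t.wa e + t.wb e) ≤ ∑ e ∈ S, (w e + ε * W) :=
          Finset.sum_le_sum fun e _ => (hsum e).2.trans (add_le_add_right (hδle e) _)
      _ = _ := by rw [Finset.sum_add_distrib, Finset.sum_const, nsmul_eq_mul]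
  have hdiff : ∑ e ∈ t.Sa \ t.Sb, t.wa e ≤
      (adjustable ε t).card * W + (t.Sa \ t.Sb).card * (ε * W) := by
    have hpt : ∀ e ∈ t.Sa \ t.Sb, t.wa e ≤ (if e ∈ adjustable ε t then W else 0) + ε * W := by
      intro e he
      have hW0 : 0 ≤ W := (hw e).trans (hW e)
      split_ifs with h
      · linarith [hwa_le e, mul_nonneg hε.le hW0]
      · linarith [hexh e he h]
    refine (Finset.sum_le_sum hpt).trans ?_
    rw [Finset.sum_add_distrib, Finset.sum_const, nsmul_eq_mul, ← Finset.sum_filter,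
      Finset.sum_const, nsmul_eq_mul]
    have : (t.Sa \ t.Sb).filter (fun e => e ∈ adjustable ε t) = adjustable ε t := by
      ext e
      simp only [Finset.mem_filter, Finset.mem_sdiff, mem_adjustable]
      tauto
    rw [this]
  -- `S` and `Sa \ Sb` are disjoint parts of `Sa`, so their `ε * W` errors together cost only one `ε
  -- * W * n`.
  have hcard : (S.card : ℝ) + (t.Sa \ t.Sb).card ≤ Fintype.card α := by
    have h1 : S.card + (t.Sa \ t.Sb).card = t.Sa.card := by
      rw [hSeq, Finset.card_inter_add_card_sdiff]
    exact_mod_cast h1.le.trans t.Sa.card_le_univ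
  -- On an empty ground set `W` may be negative, but then all sums vanish.
  rcases isEmpty_or_nonempty α with hα | ⟨⟨e₀⟩⟩
  · simp [Finset.eq_empty_of_isEmpty]
  · have hW0 : 0 ≤ W := (hw e₀).trans (hW e₀)
    have h1 := mul_le_mul_of_nonneg_right hc hW0
    have h2 := mul_le_mul_of_nonneg_right hcard (mul_nonneg hε.le hW0)
    linarith

lemma natCeil_inv_le {ε : ℝ} (hε : 0 < ε) (hε1 : ε ≤ 1) : (⌈ε⁻¹⌉₊ : ℝ) ≤ 2 * ε⁻¹ := by
  have h1 : (⌈ε⁻¹⌉₊ : ℝ) < ε⁻¹ + 1 := Nat.ceil_lt_add_one (by positivity)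
  have h2 : 1 ≤ ε⁻¹ := (one_le_inv₀ hε).2 hε1
  linarith

end

end AuctionMI

/-! ### The main theorem -/

theorem mainTheorem7 :
    ∃ C : ℝ, 0 < C ∧
      ∀ {α : Type*} [Fintype α] (Ma Mb : Matroid α),
        Ma.E = Set.univ → Mb.E = Set.univ →
      ∀ (w : α → ℝ) (W : ℝ), (∀ e, 0 ≤ w e) → (∀ e, w e ≤ W) →
      ∀ (ε : ℝ), 0 < ε →
      ∀ (tie : ℕ → AuctionMI.Side → List α),
        (∀ k i, (tie k i).Nodup ∧ ∀ e, e ∈ tie k i) →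
        (∃ (S : Finset α) (q : ℕ), AuctionMI.AuctionReturns Ma Mb w ε tie S q) ∧
        ∀ (S : Finset α) (q : ℕ), AuctionMI.AuctionReturns Ma Mb w ε tie S q →
          Ma.Indep (S : Set α) ∧ Mb.Indep (S : Set α) ∧
          (∀ T : Finset α, Ma.Indep (T : Set α) → Mb.Indep (T : Set α) →
            ∑ e ∈ T, w e - 3 * ε * W * (Fintype.card α : ℝ) ≤ ∑ e ∈ S, w e) ∧
          (ε ≤ 1 → (q : ℝ) ≤ C * ((Fintype.card α : ℝ) / ε ^ 2)) := by
  -- `10 = 8 + 2`: the loop asks at most `8 * n / ε ^ 2` queries, and the initial bases `2 * n ≤ 2 *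
  -- n / ε ^ 2`.
  refine ⟨10, by norm_num, ?_⟩
  intro α _ Ma Mb ha hb w W hw hW ε hε tie htie
  constructor
  · obtain ⟨S, q, h⟩ := AuctionMI.exists_whileRuns (AuctionMI.indepOracle Ma Mb) w hε htie
      ((AuctionMI.startUp w tie).run (AuctionMI.indepOracle Ma Mb)).1
    exact ⟨S, _, _, _, q, rfl, h, rfl⟩
  rintro S q ⟨s, q₀, q₁, hs, hrun, rfl⟩
  have hinv := AuctionMI.invariant_startUp ha hb w ε fun k i => (htie k i).2
  have hp := AuctionMI.p_startUp (AuctionMI.indepOracle Ma Mb) w tie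
  have hq₀ := AuctionMI.run_startUp_snd (AuctionMI.indepOracle Ma Mb) w htie
  simp only [hs] at hinv hp hq₀
  obtain ⟨⟨t, ht, hc, hS⟩, hq₁⟩ := hrun.exists_final ha hb hw hε htie hinv
  refine ⟨ht.optimal_a.1.subset fun e he => ((hS e).1 he).1,
    ht.optimal_b.1.subset fun e he => ((hS e).1 he).2, fun T hTa hTb => ?_, fun hε1 => ?_⟩
  · have hn : 0 ≤ W * (Fintype.card α : ℝ) := by
      rw [← nsmul_eq_mul', ← Finset.card_univ, ← Finset.sum_const]
      exact Finset.sum_nonneg fun e _ => (hw e).trans (hW e)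
    have hεn := mul_nonneg hε.le hn
    rcases le_total ε 1 with hε1 | hε1
    · have := ht.sum_le ha hb hw hW hε hε1 hc hS hTa hTb
      linarith
    -- For `ε ≥ 1` the allowed error already exceeds the total weight bound `W * n`.
    · have h1 : ∑ e ∈ T, w e ≤ W * (Fintype.card α : ℝ) := by
        rw [← nsmul_eq_mul', ← Finset.card_univ, ← Finset.sum_const]
        exact (Finset.sum_le_univ_sum_of_nonneg hw).trans (Finset.sum_le_sum fun e _ => hW e)
      have h2 := mul_le_mul_of_nonneg_right hε1 hn
      have h3 : 0 ≤ ∑ e ∈ S, w e := Finset.sum_nonneg fun e _ => hw e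
      linarith
  · have hpot : (AuctionMI.potential ε s : ℝ) = Fintype.card α * (2 * (⌈ε⁻¹⌉₊ : ℝ)) := by
      simp [AuctionMI.potential, hp]
    have hK := AuctionMI.natCeil_inv_le hε hε1
    have hn : (0 : ℝ) ≤ Fintype.card α := Nat.cast_nonneg _
    have hK' := mul_le_mul_of_nonneg_left hK hn
    rw [hpot] at hq₁
    have h1 : ε ^ 2 * (q₁ : ℝ) ≤ 8 * Fintype.card α := by
      have h2 : ε * (q₁ : ℝ) ≤ 8 * Fintype.card α * ε⁻¹ := by linarith
      have h3 := mul_le_mul_of_nonneg_left h2 hε.le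
      calc ε ^ 2 * (q₁ : ℝ) = ε * (ε * q₁) := by ring
        _ ≤ ε * (8 * Fintype.card α * ε⁻¹) := h3
        _ = 8 * Fintype.card α := by field_simp
    have h4 : ε ^ 2 * (2 * Fintype.card α : ℝ) ≤ 2 * Fintype.card α :=
      mul_le_of_le_one_left (by positivity) (pow_le_one₀ hε.le hε1)
    rw [← mul_div_assoc, le_div_iff₀ (by positivity), hq₀]
    push_cast
    linarith
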